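/- Let $(A,\mathfrak m)$ be a Noetherian local ring (commutative with unity), let $\mathfrak D$ be a set of derivations of $A$ (additive maps $d:A\to A$ with $d(ab)=a\,d(b)+b\,d(a)$), and let $I$ be a maximally $\mathfrak D$-differential ideal of $A$; that is, $I$ is a proper ideal with $d(I)\subseteq I$ for all $d\in\mathfrak D$, and no proper ideal $J\supsetneq I$ satisfies $d(J)\subseteq J$ for all $d\in\mathfrak D$. Let $n=\operatorname{emdim}(A)$ and $r=\operatorname{emdim}(A/I)$, where $\operatorname{emdim}$ of a Noetherian local ring denotes the minimal number of generators of its maximal ideal. If $A/I$ is of characteristic $p>0$, then $r\le n$ and there exists a minimal set $\{x_1,\dots,x_n\}$ of generators of $\mathfrak m$ such that $$I=(x_1^p,\dots,x_r^p,x_{r+1},\dots,x_n).$$ (The ring $A$ is not assumed to contain a field.) -/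

import Mathlib

/-- An ideal `I` of `A` is `D`-differential, for a set `D` of derivations of `A` (additive
endomorphisms satisfying the Leibniz rule), if `d I ⊆ I` for all `d ∈ D`. -/
def IsDifferentialIdeal {A : Type*} [CommRing A] (D : Set (Derivation ℤ A A)) (I : Ideal A) :
    Prop :=
  ∀ d ∈ D, ∀ a ∈ I, d a ∈ I

/-- An ideal is maximally `D`-differential if it is proper, `D`-differential, and no proper ideal
strictly containing it is `D`-differential. -/
structure IsMaximallyDifferential {A : Type*} [CommRing A] (D : Set (Derivation ℤ A A))
    (I : Ideal A) : Prop where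
  ne_top : I ≠ ⊤
  isDifferential : IsDifferentialIdeal D I
  not_isDifferential_of_lt : ∀ J : Ideal A, I < J → J ≠ ⊤ → ¬ IsDifferentialIdeal D J

/-- The embedding dimension of a (Noetherian) local ring: the minimal number of generators of its
maximal ideal. -/
noncomputable def embDim (R : Type*) [CommRing R] [IsLocalRing R] : ℕ :=
  (IsLocalRing.maximalIdeal R).spanFinrank

/-- The elements `x i` (automatically pairwise distinct) form a minimal set of generators
of the ideal `J`: they generate it, and no longer do so after leaving one of them out. -/
def IsMinimalGenerators {A ι : Type*} [CommRing A] (J : Ideal A) (x : ι → A) : Prop :=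
  Ideal.span (Set.range x) = J ∧ ∀ i, Ideal.span (x '' {i}ᶜ) ≠ J

/-- The quotient of a local ring by a maximally differential ideal is local. -/
theorem IsMaximallyDifferential.isLocalRing_quotient {A : Type*} [CommRing A] [IsLocalRing A]
    {D : Set (Derivation ℤ A A)} {I : Ideal A} (hI : IsMaximallyDifferential D I) :
    IsLocalRing (A ⧸ I) :=
  haveI : Nontrivial (A ⧸ I) := Ideal.Quotient.nontrivial_iff.mpr hI.ne_top
  IsLocalRing.of_surjective' (Ideal.Quotient.mk I) Ideal.Quotient.mk_surjective

/-! Pass to `B = A ⧸ I`, which has no nontrivial ideal stable under all its derivations. A nonunit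
killed by every derivation generates such an ideal, so it vanishes; hence `p` is prime and `b ^ p =
0` for every `b` in the maximal ideal.

The core is `exists_list`: the maximal ideal of `B` has generators `x i` with `∏ x i ^ (p - 1) ≠ 0`.
Starting from `0`, adjoin one element at a time. While the current ideal is not maximal, some
derivation preserving it sends a nonunit `x` to `1`, and `sup_span_singleton` shows that adjoining
`x` keeps the maximality needed to continue. Nonvanishing of the product forces the `x i` to be
independent modulo the square of the maximal ideal, so there are `r` of them.

Lift them to `y i` in `A` and add elements `z j` of `I` forming a basis of the image of `I` in the
cotangent space; together they generate the maximal ideal minimally. Let `J = (y i ^ p, z j) ≤ I`.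
Any `f ∉ J` has, modulo `J`, a multiple equal to a unit times `∏ y i ^ (p - 1)`. As that product is
not in `I`, no such `f` lies in `I`. -/

open Finset in
theorem Derivation.iterate_mul {B : Type*} [CommRing B] (d : Derivation ℤ B B) (n : ℕ) (a b : B) :
    d^[n] (a * b) =
      ∑ ij ∈ antidiagonal n, (n.choose ij.1 : B) * (d^[ij.1] a * d^[ij.2] b) := by
  induction n with
  | zero => simp
  | succ n ih =>
    rw [sum_antidiagonal_choose_succ_mul (fun i j => d^[i] a * d^[j] b), Function.iterate_succ_apply',
      ih, map_sum, ← sum_add_distrib]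
    refine sum_congr rfl fun ij hij => ?_
    have hc : n.choose ij.2 = n.choose ij.1 :=
      Nat.choose_symm_of_eq_add (by rw [HasAntidiagonal.mem_antidiagonal] at hij; omega)
    simp only [Derivation.leibniz, Derivation.map_natCast, smul_eq_mul, mul_zero, add_zero,
      Function.iterate_succ_apply', hc]
    ring

/-- In characteristic `p`, the `p`-th iterate of a derivation is a derivation. -/
def Derivation.frobeniusPow {B : Type*} [CommRing B] (p : ℕ) [Fact p.Prime] [CharP B p]
    (d : Derivation ℤ B B) : Derivation ℤ B B :=
  Derivation.mk' ((d : B →ₗ[ℤ] B) ^ p) fun a b => by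
    have hp : p.Prime := Fact.out
    simp only [Module.End.pow_apply, Derivation.coeFn_coe, smul_eq_mul]
    rw [d.iterate_mul, Finset.Nat.sum_antidiagonal_eq_sum_range_succ_mk, Finset.sum_range_succ,
      Finset.sum_eq_single_of_mem 0 (by simp [hp.pos])]
    · simp [mul_comm b]
    · intro i hi hi0
      rw [(CharP.cast_eq_zero_iff B p _).2
        (hp.dvd_choose_self hi0 (Finset.mem_range.1 hi)), zero_mul]

theorem Derivation.frobeniusPow_apply {B : Type*} [CommRing B] (p : ℕ) [Fact p.Prime] [CharP B p]
    (d : Derivation ℤ B B) (b : B) : d.frobeniusPow p b = d^[p] b := by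
  simp [Derivation.frobeniusPow, Module.End.pow_apply]

/-! ### Derivations with an element of derivative `1` -/

section

variable {B : Type*} [CommRing B] (d : Derivation ℤ B B) {x : B}

theorem Derivation.pow_dvd_apply (hx : d x = 1) {k : ℕ} {a : B} (h : x ^ (k + 1) ∣ a) :
    x ^ k ∣ d a := by
  obtain ⟨c, rfl⟩ := h
  refine ⟨(k + 1) * c + x * d c, ?_⟩
  simp only [Derivation.leibniz, Derivation.leibniz_pow, hx, smul_eq_mul, nsmul_eq_mul,
    Nat.add_sub_cancel]
  push_cast
  ring

theorem Derivation.pow_dvd_iterate (hx : d x = 1) {k i : ℕ} {a : B} (h : x ^ (k + i) ∣ a) :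
    x ^ k ∣ d^[i] a := by
  induction i generalizing a with
  | zero => simpa using h
  | succ i ih => exact ih (d.pow_dvd_apply hx h)

theorem Derivation.iterate_pow_mul (hx : d x = 1) (k : ℕ) (y : B) :
    x ∣ d^[k] (x ^ k * y) - k.factorial * y := by
  induction k generalizing y with
  | zero => simp
  | succ k ih =>
    have h1 : d (x ^ (k + 1) * y) = x ^ k * ((k + 1) * y) + x ^ (k + 1) * d y := by
      simp only [Derivation.leibniz, Derivation.leibniz_pow, hx, smul_eq_mul, nsmul_eq_mul,
        Nat.add_sub_cancel]
      push_cast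
      ring
    rw [Function.iterate_succ_apply, h1, iterate_map_add]
    have h2 : x ∣ d^[k] (x ^ (k + 1) * d y) := by
      simpa using d.pow_dvd_iterate hx (k := 1) (i := k) (by rw [add_comm]; exact dvd_mul_right _ _)
    have h3 := dvd_add (ih ((k + 1) * y)) h2
    rw [Nat.factorial_succ]
    convert h3 using 1
    push_cast
    ring

theorem isUnit_natCast_of_lt {p : ℕ} (hp : p.Prime) [CharP B p] {k : ℕ} (h0 : k ≠ 0) (hk : k < p) :
    IsUnit (k : B) :=
  (CharP.isUnit_natCast_iff hp).2 fun h => (Nat.le_of_dvd (Nat.pos_of_ne_zero h0) h).not_gt hk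

/-- Truncated integration: if `d c = x ^ k * e`, subtracting `x ^ (k + 1) * e / (k + 1)` raises the
order of the derivative by one. The division is possible as long as `k + 1 < p`. -/
theorem Derivation.exists_pow_dvd (hx : d x = 1) {p : ℕ} (hp : p.Prime) [CharP B p] (b : B) {k : ℕ}
    (hk : k < p) : ∃ c, x ∣ c - b ∧ x ^ k ∣ d c := by
  induction k with
  | zero => exact ⟨b, by simp, by simp⟩
  | succ k ih =>
    obtain ⟨c, hc, e, he⟩ := ih (by omega)
    obtain ⟨u, hu⟩ := (isUnit_natCast_of_lt (B := B) hp k.succ_ne_zero hk).exists_right_inv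
    refine ⟨c - x ^ (k + 1) * (u * e), ?_, -d (u * e), ?_⟩
    · rw [sub_right_comm]
      exact dvd_sub hc (Dvd.intro_left (x ^ k * (u * e)) (by ring))
    · rw [map_sub, he, Derivation.leibniz (d) (x ^ (k+1)), Derivation.leibniz_pow, hx]
      simp only [smul_eq_mul, nsmul_eq_mul, Nat.add_sub_cancel]
      linear_combination -x ^ k * e * hu

end

/-! ### Stable ideals and the chain of maximal ones -/

section

variable {B : Type*} [CommRing B]

/-- The largest ideal contained in `J` that is stable under the derivation `d`. -/
def Ideal.derivationCore (d : Derivation ℤ B B) (J : Ideal B) : Ideal B where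
  carrier := {b | ∀ i, d^[i] b ∈ J}
  add_mem' ha hb i := by
    rw [iterate_map_add]
    exact J.add_mem (ha i) (hb i)
  zero_mem' i := by
    rw [iterate_map_zero]
    exact J.zero_mem
  smul_mem' c b hb i := by
    rw [smul_eq_mul, d.iterate_mul]
    exact J.sum_mem fun ij _ => J.mul_mem_left _ (J.mul_mem_left _ (hb _))

theorem Ideal.apply_mem_derivationCore {d : Derivation ℤ B B} {J : Ideal B} {b : B}
    (hb : b ∈ J.derivationCore d) : d b ∈ J.derivationCore d :=
  fun i => hb (i + 1)

/-- Move `δ` past `d` by `d δ = ⁅d, δ⁆ + δ d`; the induction must run over all `δ ∈ L` at once,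
since the bracket replaces `δ`. -/
theorem Ideal.derivationCore_stable {d : Derivation ℤ B B} {J : Ideal B}
    (L : Set (Derivation ℤ B B)) (hL : ∀ δ ∈ L, ⁅d, δ⁆ ∈ L) (hJ : IsDifferentialIdeal L J) :
    IsDifferentialIdeal L (J.derivationCore d) := by
  intro δ hδ b hb i
  induction i generalizing δ b with
  | zero => exact hJ δ hδ b (hb 0)
  | succ i ih =>
    have h : d (δ b) = ⁅d, δ⁆ b + δ (d b) := by
      rw [Derivation.commutator_apply, sub_add_cancel]
    rw [Function.iterate_succ_apply, h, iterate_map_add]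
    exact J.add_mem (ih _ (hL δ hδ) b hb) (ih δ hδ _ (Ideal.apply_mem_derivationCore hb))

/-- The derivations that map the ideal `I` into itself. -/
def Ideal.stabilizingDerivations (I : Ideal B) : Set (Derivation ℤ B B) :=
  {δ | ∀ a ∈ I, δ a ∈ I}

/-- Adjoining to `I` an element with derivative `1` keeps it maximal among the proper ideals
stable under its own derivations. -/
theorem IsMaximallyDifferential.sup_span_singleton {p : ℕ} [Fact p.Prime] [CharP B p] {I : Ideal B}
    (hI : IsMaximallyDifferential I.stabilizingDerivations I) {d : Derivation ℤ B B}
    (hd : d ∈ I.stabilizingDerivations) {x : B} (hx : d x = 1) (hne : I ⊔ Ideal.span {x} ≠ ⊤) :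
    IsMaximallyDifferential (I ⊔ Ideal.span {x}).stabilizingDerivations (I ⊔ Ideal.span {x}) := by
  refine ⟨hne, fun δ hδ => hδ, fun J hIJ hJ hstab => hIJ.not_ge ?_⟩
  have hp : p.Prime := Fact.out
  -- Killing `x` makes these derivations preserve `I + (x)`, hence `J`; `d` itself need not preserve
  -- `J`.
  set L : Set (Derivation ℤ B B) := {δ | δ ∈ I.stabilizingDerivations ∧ δ x = 0} with hLdef
  have hxJ : x ∈ J := hIJ.le (Ideal.mem_sup_right (Ideal.mem_span_singleton_self x))
  have hdvd : ∀ {a}, x ∣ a → a ∈ J := fun h => J.mem_of_dvd h hxJ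
  have hLJ : IsDifferentialIdeal L J := by
    intro δ hδ
    refine hstab δ fun a ha => ?_
    obtain ⟨u, hu, v, hv, rfl⟩ := Submodule.mem_sup.1 ha
    obtain ⟨w, rfl⟩ := Ideal.mem_span_singleton.1 hv
    rw [map_add, Derivation.leibniz, hδ.2, smul_zero, add_zero]
    exact add_mem (Ideal.mem_sup_left (hδ.1 u hu))
      (Ideal.mem_sup_right (Ideal.mem_span_singleton.2 (dvd_mul_right _ _)))
  have hbr : ∀ δ ∈ L, ⁅d, δ⁆ ∈ L := by
    refine fun δ hδ => ⟨fun a ha => ?_, ?_⟩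
    · rw [Derivation.commutator_apply]
      exact I.sub_mem (hd _ (hδ.1 a ha)) (hδ.1 _ (hd a ha))
    · rw [Derivation.commutator_apply, hδ.2, hx, map_zero, Derivation.map_one_eq_zero, sub_zero]
  have hcore : J.derivationCore d ≤ I := by
    have hle : I ≤ J.derivationCore d := by
      intro a ha i
      refine hIJ.le (Ideal.mem_sup_left ?_)
      induction i generalizing a with
      | zero => exact ha
      | succ i ih => exact ih (hd a ha)
    by_contra hcon
    refine hI.not_isDifferential_of_lt _ (lt_of_le_not_ge hle hcon) ?_ ?_
    · rw [Ne, Ideal.eq_top_iff_one]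
      exact fun h => hJ ((Ideal.eq_top_iff_one J).2 (h 0))
    · intro δ hδ a ha
      -- Every derivation preserving `I` is one in `L` plus a multiple of `d`, and the core is
      -- stable under both.
      have h0 : δ - δ x • d ∈ L := by
        refine ⟨fun b hb => ?_, by simp [hx]⟩
        simpa using I.sub_mem (hδ b hb) (I.mul_mem_left _ (hd b hb))
      have h1 := add_mem (Ideal.derivationCore_stable L hbr hLJ _ h0 a ha)
        (Ideal.mul_mem_left _ (δ x) (Ideal.apply_mem_derivationCore ha))
      simpa using h1
  have hiter : ∀ i, d^[i + 2] x = 0 := fun i => by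
    rw [Function.iterate_add_apply, Function.iterate_succ_apply, hx, Function.iterate_one,
      Derivation.map_one_eq_zero, iterate_map_zero]
  have hpow : d.frobeniusPow p ∈ L := by
    refine ⟨fun a ha => ?_, ?_⟩
    · rw [Derivation.frobeniusPow_apply]
      exact (Set.MapsTo.iterate (f := d) (s := (I : Set B)) (fun a ha => hd a ha) p) ha
    · rw [Derivation.frobeniusPow_apply, ← Nat.sub_add_cancel hp.two_le, hiter]
  intro b hb
  -- With `x ^ (p - 1) ∣ d c`, the iterates of orders `1` to `p - 1` stay in `(x) ≤ J`. From order
  -- `p` on, split off `d ^ p`, which preserves `J` because it lies in `L`.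
  obtain ⟨c, hcb, hdc⟩ := d.exists_pow_dvd hx hp b (Nat.sub_lt hp.pos one_pos)
  have hc : c ∈ J.derivationCore d := by
    intro i
    induction i using Nat.strong_induction_on with
    | _ i ih =>
      rcases Nat.eq_zero_or_pos i with rfl | hi
      · simpa using J.add_mem (hdvd hcb) hb
      rcases lt_or_ge i p with hip | hip
      · obtain ⟨i, rfl⟩ := Nat.exists_eq_add_of_lt hi
        rw [zero_add] at hip ⊢
        refine hdvd ?_
        simpa using d.pow_dvd_iterate hx (k := 1) (i := i)
          ((pow_dvd_pow x (by omega)).trans hdc)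
      · obtain ⟨k, rfl⟩ := Nat.exists_eq_add_of_le hip
        rw [Function.iterate_add_apply, ← Derivation.frobeniusPow_apply]
        exact hLJ _ hpow _ (ih k (by have := hp.pos; omega))
  have := Submodule.add_mem_sup (hcore hc)
    (Ideal.mem_span_singleton.2 ((dvd_neg (a := x)).2 hcb))
  simpa using this

/-- The maximal ideal is generated, modulo `I`, by elements whose product of `(p - 1)`-st powers
does not vanish modulo `I`. -/
theorem IsMaximallyDifferential.exists_list [IsLocalRing B] [IsNoetherianRing B]
    {p : ℕ} [Fact p.Prime] [CharP B p] (I : Ideal B)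
    (hI : IsMaximallyDifferential I.stabilizingDerivations I) :
    ∃ l : List B, I ⊔ Ideal.span {y | y ∈ l} = IsLocalRing.maximalIdeal B ∧
      (l.map (· ^ (p - 1))).prod ∉ I := by
  induction I using WellFoundedGT.induction with
  | _ I ih =>
  have hp : p.Prime := Fact.out
  set m := IsLocalRing.maximalIdeal B with hm
  rcases (IsLocalRing.le_maximalIdeal hI.ne_top).eq_or_lt with heq | hlt
  · refine ⟨[], by simpa using heq, by simpa using (Ideal.ne_top_iff_one I).1 hI.ne_top⟩
  obtain ⟨d, hd, x, hxm, hx⟩ : ∃ d ∈ I.stabilizingDerivations, ∃ x ∈ m, d x = 1 := by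
    have := hI.not_isDifferential_of_lt m hlt (IsLocalRing.maximalIdeal.isMaximal B).ne_top
    simp only [IsDifferentialIdeal, not_forall] at this
    obtain ⟨d, hd, x, hxm, hdx⟩ := this
    obtain ⟨u, hu⟩ := (IsLocalRing.notMem_maximalIdeal.1 hdx).exists_left_inv
    exact ⟨u • d, fun a ha => I.mul_mem_left u (hd a ha), x, hxm, by simpa using hu⟩
  have hle : I ⊔ Ideal.span {x} ≤ m :=
    sup_le hlt.le ((Ideal.span_singleton_le_iff_mem _).2 hxm)
  have hne : I ⊔ Ideal.span {x} ≠ ⊤ :=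
    ne_top_of_le_ne_top (IsLocalRing.maximalIdeal.isMaximal B).ne_top hle
  have hgt : I < I ⊔ Ideal.span {x} := by
    refine lt_of_le_of_ne le_sup_left fun h => (Ideal.ne_top_iff_one I).1 hI.ne_top ?_
    rw [← hx]
    exact hd x (h ▸ Ideal.mem_sup_right (Ideal.mem_span_singleton_self x))
  obtain ⟨l, hl, hprod⟩ := ih _ hgt (hI.sup_span_singleton hd hx hne)
  refine ⟨x :: l, ?_, fun hmem => hprod ?_⟩
  · rw [← hl, sup_assoc, ← Ideal.span_union]
    congr 2
    ext
    simp
  · set y := (l.map (· ^ (p - 1))).prod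
    rw [List.map_cons, List.prod_cons] at hmem
    -- Modulo `x` this is `(p - 1)! * y`, and `(p - 1)!` is a unit.
    have h1 : d^[p - 1] (x ^ (p - 1) * y) ∈ I :=
      (Set.MapsTo.iterate (f := d) (s := (I : Set B)) (fun a ha => hd a ha) (p - 1)) hmem
    have h2 := Submodule.add_mem_sup h1 (Ideal.mem_span_singleton.2
      ((dvd_neg (a := x)).2 (d.iterate_pow_mul hx (p - 1) y)))
    have h3 : IsUnit ((p - 1).factorial : B) := (CharP.isUnit_natCast_iff hp).2 fun h =>
      absurd (hp.dvd_factorial.1 h) (by have := hp.pos; omega)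
    refine ((I ⊔ Ideal.span {x}).unit_mul_mem_iff_mem h3).1 ?_
    simpa using h2

end

/-! ### Differentially simple quotients -/

section

variable {A : Type*} [CommRing A]

/-- The derivation of `A ⧸ I` induced by a derivation of `A` that maps `I` into itself. -/
def Derivation.quotientMap (d : Derivation ℤ A A) (I : Ideal A) (h : ∀ a ∈ I, d a ∈ I) :
    Derivation ℤ (A ⧸ I) (A ⧸ I) :=
  Derivation.mk' (QuotientAddGroup.map I.toAddSubgroup I.toAddSubgroup
    (d : A →ₗ[ℤ] A).toAddMonoidHom h).toIntLinearMap <| by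
      intro a b
      obtain ⟨a, rfl⟩ := Ideal.Quotient.mk_surjective a
      obtain ⟨b, rfl⟩ := Ideal.Quotient.mk_surjective b
      change Ideal.Quotient.mk I (d (a * b)) = Ideal.Quotient.mk I a * Ideal.Quotient.mk I (d b) +
        Ideal.Quotient.mk I b * Ideal.Quotient.mk I (d a)
      simp

theorem Derivation.quotientMap_mk (d : Derivation ℤ A A) (I : Ideal A) (h : ∀ a ∈ I, d a ∈ I)
    (a : A) : d.quotientMap I h (Ideal.Quotient.mk I a) = Ideal.Quotient.mk I (d a) :=
  rfl

theorem IsMaximallyDifferential.quotient {D : Set (Derivation ℤ A A)} {I : Ideal A}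
    (hI : IsMaximallyDifferential D I) :
    IsMaximallyDifferential (⊥ : Ideal (A ⧸ I)).stabilizingDerivations (⊥ : Ideal (A ⧸ I)) := by
  have : Nontrivial (A ⧸ I) := Ideal.Quotient.nontrivial_iff.mpr hI.ne_top
  refine ⟨bot_ne_top, fun d hd => hd, fun J hJ hJ' hstab => ?_⟩
  have hle : I ≤ J.comap (Ideal.Quotient.mk I) := fun a ha => by
    rw [Ideal.mem_comap, Ideal.Quotient.eq_zero_iff_mem.2 ha]
    exact J.zero_mem
  refine hI.not_isDifferential_of_lt (J.comap (Ideal.Quotient.mk I))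
    (lt_of_le_not_ge hle fun hge => hJ.not_ge fun b hb => ?_) (Ideal.comap_ne_top _ hJ')
    fun d hd a ha => ?_
  · obtain ⟨a, rfl⟩ := Ideal.Quotient.mk_surjective b
    exact (Ideal.mem_bot).2 (Ideal.Quotient.eq_zero_iff_mem.2 (hge hb))
  · rw [Ideal.mem_comap, ← d.quotientMap_mk I (hI.isDifferential d hd)]
    refine hstab _ (fun b hb => ?_) _ ha
    obtain rfl := Ideal.mem_bot.1 hb
    exact Ideal.mem_bot.2 (map_zero (d.quotientMap I (hI.isDifferential d hd)))

/-- A nonunit killed by all derivations vanishes if there are no nontrivial differential ideals. -/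
theorem IsMaximallyDifferential.eq_zero_of_forall_derivation
    (hA : IsMaximallyDifferential (⊥ : Ideal A).stabilizingDerivations (⊥ : Ideal A)) {c : A}
    (hc : ¬ IsUnit c) (hd : ∀ d : Derivation ℤ A A, d c = 0) : c = 0 := by
  by_contra h0
  refine hA.not_isDifferential_of_lt (Ideal.span {c})
    (bot_lt_iff_ne_bot.2 (by simpa [Ideal.span_singleton_eq_bot] using h0))
    (by rwa [Ne, Ideal.span_singleton_eq_top]) fun d _ a ha => ?_
  obtain ⟨b, rfl⟩ := Ideal.mem_span_singleton.1 ha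
  rw [Derivation.leibniz, hd, smul_zero, add_zero]
  exact Ideal.mem_span_singleton.2 (dvd_mul_right _ _)

/-- The least prime factor `q` of `p` is a zero divisor, as `q * (p / q) = 0`, and all derivations
kill it; so it is zero and `p ∣ q`. -/
theorem IsMaximallyDifferential.charP_prime
    (hA : IsMaximallyDifferential (⊥ : Ideal A).stabilizingDerivations (⊥ : Ideal A))
    {p : ℕ} (hp : 0 < p) [CharP A p] : p.Prime := by
  have : Nontrivial A := by
    by_contra h
    have := not_nontrivial_iff_subsingleton.1 h
    exact hA.ne_top (Subsingleton.elim _ _)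
  have h1 : p ≠ 1 := CharP.char_ne_one A p
  have hq := Nat.minFac_prime h1
  obtain ⟨k, hk⟩ := Nat.minFac_dvd p
  have hzero : (p.minFac : A) = 0 := by
    refine hA.eq_zero_of_forall_derivation (fun hu => ?_) fun d => d.map_natCast _
    have : (p.minFac : A) * k = 0 := by rw [← Nat.cast_mul, ← hk, CharP.cast_eq_zero]
    have hk0 := (CharP.cast_eq_zero_iff A p k).1 ((hu.mul_right_eq_zero).1 this)
    have hkpos : 0 < k := by
      rcases Nat.eq_zero_or_pos k with rfl | h
      · simp at hk; omega
      · exact h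
    have := Nat.le_of_dvd hkpos hk0
    have := hq.two_le
    nlinarith
  have : p = p.minFac := Nat.dvd_antisymm ((CharP.cast_eq_zero_iff A p _).1 hzero) (Nat.minFac_dvd p)
  rw [this]
  exact hq

theorem IsMaximallyDifferential.pow_char_eq_zero [IsLocalRing A]
    (hA : IsMaximallyDifferential (⊥ : Ideal A).stabilizingDerivations (⊥ : Ideal A))
    {p : ℕ} (hp : p.Prime) [CharP A p] {b : A} (hb : b ∈ IsLocalRing.maximalIdeal A) :
    b ^ p = 0 := by
  refine hA.eq_zero_of_forall_derivation (fun h => hb ((isUnit_pow_iff hp.ne_zero).1 h)) fun d => ?_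
  rw [Derivation.leibniz_pow, nsmul_eq_mul, CharP.cast_eq_zero, zero_mul]

/-! ### Top monomials and embedding dimension -/

theorem Ideal.exists_pow_mul_mem_sup_span (J : Ideal A) {y f : A} {p : ℕ} (hy : y ^ p ∈ J)
    (hf : f ∉ J) : ∃ g, g ∉ J ⊔ Ideal.span {y} ∧ y ^ (p - 1) * g ∈ J ⊔ Ideal.span {f} := by
  classical
  -- Let `k + 1` be the least such exponent. Then `f = j + y ^ k * g` with `j ∈ J`, and minimality
  -- keeps `g` out of `J + (y)`; multiply by `y ^ (p - 1 - k)`.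
  have hex : ∃ k, f ∉ J ⊔ Ideal.span {y ^ k} :=
    ⟨p, by rwa [sup_eq_left.2 ((Ideal.span_singleton_le_iff_mem _).2 hy)]⟩
  have hk := Nat.find_spec hex
  have hkp : Nat.find hex ≤ p := Nat.find_min' hex
    (by rwa [sup_eq_left.2 ((Ideal.span_singleton_le_iff_mem _).2 hy)])
  obtain ⟨k, hk'⟩ : ∃ k, Nat.find hex = k + 1 := by
    refine Nat.exists_eq_succ_of_ne_zero fun h0 => ?_
    rw [h0] at hk
    simp at hk
  have hmin : f ∈ J ⊔ Ideal.span {y ^ k} := not_not.1 (Nat.find_min hex (by omega))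
  rw [hk'] at hk hkp
  obtain ⟨j, hj, v, hv, rfl⟩ := Submodule.mem_sup.1 hmin
  obtain ⟨g, rfl⟩ := Ideal.mem_span_singleton.1 hv
  refine ⟨g, fun hg => hk ?_, ?_⟩
  · obtain ⟨a, ha, w, hw, rfl⟩ := Submodule.mem_sup.1 hg
    obtain ⟨w, rfl⟩ := Ideal.mem_span_singleton.1 hw
    have := Submodule.add_mem_sup (J.add_mem hj (J.mul_mem_left (y ^ k) ha))
      (Ideal.mem_span_singleton.2 (dvd_mul_right (y ^ (k + 1)) w))
    convert this using 1
    ring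
  · obtain ⟨t, rfl⟩ := Nat.exists_eq_add_of_le hkp
    have := Submodule.add_mem_sup (J.neg_mem (J.mul_mem_left (y ^ t) hj))
      (Ideal.mem_span_singleton.2 (dvd_mul_left (j + y ^ k * g) (y ^ t)))
    convert this using 1
    rw [show k + 1 + t - 1 = t + k by omega]
    ring

theorem Ideal.exists_prod_pow_mul_mem_sup_span (l : List A) {p : ℕ} (hp : 0 < p) (J : Ideal A)
    (hl : ∀ y ∈ l, y ^ p ∈ J) {f : A} (hf : f ∉ J) :
    ∃ g, g ∉ J ⊔ Ideal.span {y | y ∈ l} ∧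
      (l.map (· ^ (p - 1))).prod * g ∈ J ⊔ Ideal.span {f} := by
  induction l generalizing J f with
  | nil =>
    refine ⟨f, by simpa using hf, ?_⟩
    simpa using (Ideal.mem_sup_right (Ideal.mem_span_singleton_self f) : f ∈ J ⊔ Ideal.span {f})
  | cons y l ih =>
    obtain ⟨g, hg, hgf⟩ := J.exists_pow_mul_mem_sup_span (hl y (by simp)) hf
    obtain ⟨h, hh, hhg⟩ := ih (J ⊔ Ideal.span {y})
      (fun z hz => Ideal.mem_sup_left (hl z (by simp [hz]))) hg
    refine ⟨h, ?_, ?_⟩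
    · rw [sup_assoc, ← Ideal.span_union] at hh
      convert hh using 4
      ext
      simp
    · rw [List.map_cons, List.prod_cons, mul_assoc]
      have key : J ⊔ Ideal.span {y} ⊔ Ideal.span {g} ≤
          Submodule.comap (LinearMap.mulLeft A (y ^ (p - 1))) (J ⊔ Ideal.span {f}) := by
        refine sup_le (sup_le (fun a ha => ?_) ?_) ?_
        · exact Ideal.mul_mem_left _ _ (Ideal.mem_sup_left ha)
        · refine (Submodule.span_singleton_le_iff_mem _ _).2 (Ideal.mem_sup_left ?_)
          rw [LinearMap.mulLeft_apply, pow_sub_one_mul hp.ne']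
          exact hl y (by simp)
        · exact (Submodule.span_singleton_le_iff_mem _ _).2 hgf
      exact key hhg

/-- If the product of the `(p - 1)`-st powers of generators of `m` with vanishing `p`-th powers is
nonzero, then the generators are linearly independent modulo `m ^ 2`. -/
theorem IsLocalRing.mem_maximalIdeal_of_sum_mem_sq [IsLocalRing A] {p s : ℕ} (hp : 2 ≤ p)
    {x : Fin s → A} (hspan : Ideal.span (Set.range x) = IsLocalRing.maximalIdeal A)
    (hx : ∀ i, x i ^ p = 0) (hprod : ∏ i, x i ^ (p - 1) ≠ 0) {a : Fin s → A}
    (ha : ∑ i, a i * x i ∈ IsLocalRing.maximalIdeal A ^ 2) (j : Fin s) :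
    a j ∈ IsLocalRing.maximalIdeal A := by
  classical
  by_contra hj
  have hu := IsLocalRing.notMem_maximalIdeal.1 hj
  set P := ∏ i, x i ^ (p - 1) with hP
  -- The top monomial `P` with one factor `x j` removed: multiplication by `Q` kills `m ^ 2` and
  -- every `x i` except `x j`, so it isolates the `j`-th coefficient.
  set Q := x j ^ (p - 2) * ∏ i ∈ Finset.univ.erase j, x i ^ (p - 1) with hQ
  have hxp : ∀ i, x i * x i ^ (p - 1) = 0 := fun i => by
    rw [mul_pow_sub_one (by omega), hx]
  have hQj : x j * Q = P := by
    rw [hP, hQ, ← Finset.mul_prod_erase _ _ (Finset.mem_univ j), ← mul_assoc, ← pow_succ']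
    congr 3
    omega
  have hQi : ∀ i, i ≠ j → x i * Q = 0 := by
    intro i hij
    rw [hQ, ← Finset.mul_prod_erase _ _ (Finset.mem_erase.2 ⟨hij, Finset.mem_univ i⟩),
      mul_left_comm, ← mul_assoc (x i), hxp, zero_mul, mul_zero]
  have hPi : ∀ i, x i * P = 0 := fun i => by
    rw [hP, ← Finset.mul_prod_erase _ _ (Finset.mem_univ i), ← mul_assoc, hxp, zero_mul]
  have hmP : ∀ c ∈ IsLocalRing.maximalIdeal A, c * P = 0 := by
    intro c hc
    rw [← hspan] at hc
    obtain ⟨e, rfl⟩ := Ideal.mem_span_range_iff_exists_fun.1 hc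
    rw [Finset.sum_mul]
    exact Finset.sum_eq_zero fun i _ => by rw [mul_assoc, hPi, mul_zero]
  have hsum : ∀ e : Fin s → A, (∑ i, e i * x i) * Q = e j * P := by
    intro e
    rw [Finset.sum_mul, Finset.sum_eq_single j, mul_assoc, hQj]
    · exact fun i _ hij => by rw [mul_assoc, hQi i hij, mul_zero]
    · simp
  have hsq : ∀ c ∈ IsLocalRing.maximalIdeal A ^ 2, c * Q = 0 := by
    intro c hc
    rw [pow_two] at hc
    induction hc using Submodule.mul_induction_on' with
    | mem_mul_mem u hu v hv =>
      rw [← hspan] at hv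
      obtain ⟨e, rfl⟩ := Ideal.mem_span_range_iff_exists_fun.1 hv
      rw [mul_assoc, hsum, mul_left_comm, hmP u hu, mul_zero]
    | add u _ v _ hu hv => rw [add_mul, hu, hv, add_zero]
  have := hsq _ ha
  rw [hsum] at this
  exact hprod ((hu.mul_right_eq_zero).1 this)

theorem IsLocalRing.card_eq_embDim [IsLocalRing A] [IsNoetherianRing A] {ι : Type*} [Fintype ι]
    {x : ι → A} (hspan : Ideal.span (Set.range x) = IsLocalRing.maximalIdeal A)
    (hx : ∀ a : ι → A, ∑ i, a i * x i ∈ IsLocalRing.maximalIdeal A ^ 2 →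
      ∀ i, a i ∈ IsLocalRing.maximalIdeal A) : Fintype.card ι = embDim A := by
  have hmem : ∀ i, x i ∈ IsLocalRing.maximalIdeal A := fun i =>
    hspan ▸ Ideal.subset_span (Set.mem_range_self i)
  refine le_antisymm ?_ ?_
  · rw [embDim, IsLocalRing.spanFinrank_maximalIdeal_eq_finrank_cotangentSpace]
    refine LinearIndependent.fintype_card_le_finrank
      (b := fun i => (IsLocalRing.maximalIdeal A).toCotangent ⟨x i, hmem i⟩) ?_
    rw [Fintype.linearIndependent_iff]
    intro g hg i
    choose a ha using fun i => IsLocalRing.residue_surjective (g i)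
    rw [← ha, IsLocalRing.residue_eq_zero_iff]
    refine hx a ?_ i
    have : (IsLocalRing.maximalIdeal A).toCotangent (∑ i, a i • ⟨x i, hmem i⟩) = 0 := by
      rw [map_sum, ← hg]
      refine Finset.sum_congr rfl fun i _ => ?_
      rw [map_smul, ← ha]
      rfl
    simpa using (Ideal.toCotangent_eq_zero _ _).1 this
  · rw [embDim, ← hspan, ← Nat.card_eq_fintype_card, ← Set.ncard_univ]
    refine (Submodule.spanFinrank_span_le_ncard_of_finite (Set.finite_range x)).trans ?_
    rw [← Set.image_univ]
    exact Set.ncard_image_le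

theorem IsLocalRing.isMinimalGenerators [IsLocalRing A] {n : ℕ} (hn : n = embDim A) {x : Fin n → A}
    (hspan : Ideal.span (Set.range x) = IsLocalRing.maximalIdeal A) :
    IsMinimalGenerators (IsLocalRing.maximalIdeal A) x := by
  subst hn
  refine ⟨hspan, fun i h => ?_⟩
  have h1 : embDim A ≤ (x '' {i}ᶜ).ncard := by
    conv_lhs => rw [embDim, ← h]
    exact Submodule.spanFinrank_span_le_ncard_of_finite (Set.toFinite _)
  have h2 : (x '' {i}ᶜ).ncard ≤ ({i}ᶜ : Set (Fin (embDim A))).ncard := Set.ncard_image_le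
  rw [Set.ncard_compl] at h2
  simp only [Nat.card_eq_fintype_card, Fintype.card_fin, Set.ncard_singleton] at h2
  have := i.pos
  omega

/-- An ideal contained in `m` has elements that form a basis of its image in `m ⧸ m ^ 2`. -/
theorem IsLocalRing.exists_basis_mod_sq [IsLocalRing A] [IsNoetherianRing A] {I : Ideal A}
    (hI : I ≤ IsLocalRing.maximalIdeal A) :
    ∃ (t : ℕ) (z : Fin t → A), (∀ i, z i ∈ I) ∧
      I ≤ Ideal.span (Set.range z) ⊔ IsLocalRing.maximalIdeal A ^ 2 ∧
      ∀ a : Fin t → A, ∑ i, a i * z i ∈ IsLocalRing.maximalIdeal A ^ 2 →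
        ∀ i, a i ∈ IsLocalRing.maximalIdeal A := by
  set m := IsLocalRing.maximalIdeal A with hm
  let W : Submodule (IsLocalRing.ResidueField A) (IsLocalRing.CotangentSpace A) :=
    { (Submodule.map m.toCotangent (Submodule.comap (Submodule.subtype m) I)) with
      smul_mem' := by
        intro c v hv
        obtain ⟨c, rfl⟩ := IsLocalRing.residue_surjective c
        exact (Submodule.map m.toCotangent (Submodule.comap (Submodule.subtype m) I)).smul_mem c hv }
  let b := Module.finBasis (IsLocalRing.ResidueField A) W
  have hW : ∀ i, ∃ z : m, (z : A) ∈ I ∧ m.toCotangent z = b i := fun i => (b i).2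
  choose z hzI hz using hW
  have hcomb : ∀ a : Fin (Module.finrank (IsLocalRing.ResidueField A) W) → A,
      m.toCotangent (∑ i, a i • z i) = (∑ i, IsLocalRing.residue A (a i) • b i : W) := by
    intro a
    rw [map_sum, AddSubmonoidClass.coe_finsetSum]
    refine Finset.sum_congr rfl fun i _ => ?_
    rw [map_smul, hz]
    rfl
  refine ⟨_, fun i => z i, hzI, fun f hf => ?_, fun a ha i => ?_⟩
  · have hfW : m.toCotangent ⟨f, hI hf⟩ ∈ W := ⟨⟨f, hI hf⟩, hf, rfl⟩
    choose a ha using fun i => IsLocalRing.residue_surjective (b.repr ⟨_, hfW⟩ i)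
    have h1 := hcomb a
    simp only [ha, b.sum_repr] at h1
    have h2 := (Ideal.toCotangent_eq _).1 h1.symm
    have h3 := Submodule.add_mem_sup (Ideal.mem_span_range_iff_exists_fun.2
      ⟨a, rfl⟩ : ∑ i, a i * (z i : A) ∈ Ideal.span (Set.range fun i => (z i : A))) h2
    simpa using h3
  · have h1 : m.toCotangent (∑ i, a i • z i) = 0 := by
      rw [Ideal.toCotangent_eq_zero]
      simpa using ha
    rw [hcomb, ZeroMemClass.coe_eq_zero] at h1
    exact (IsLocalRing.residue_eq_zero_iff _).1 (Fintype.linearIndependent_iff.1 b.linearIndependent _ h1 i)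

end

/-! ### Lifting generators from `A ⧸ I` to `A` -/

theorem theorem2 {A : Type*} [CommRing A] [IsLocalRing A] [IsNoetherianRing A]
    (D : Set (Derivation ℤ A A)) (I : Ideal A) (hI : IsMaximallyDifferential D I)
    (p : ℕ) (hp : 0 < p) [CharP (A ⧸ I) p]
    (n r : ℕ) (hn : n = embDim A)
    (hr : r = @embDim (A ⧸ I) _ hI.isLocalRing_quotient) :
    r ≤ n ∧ ∃ x : Fin n → A,
      IsMinimalGenerators (IsLocalRing.maximalIdeal A) x ∧
      I = Ideal.span (Set.range fun i : Fin n => if (i : ℕ) < r then x i ^ p else x i) := by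
  have := hI.isLocalRing_quotient
  have hB := hI.quotient
  have hprime : p.Prime := hB.charP_prime hp
  have : Fact p.Prime := ⟨hprime⟩
  set m := IsLocalRing.maximalIdeal A with hm
  set π := Ideal.Quotient.mk I with hπ
  have hIm : I ≤ m := IsLocalRing.le_maximalIdeal hI.ne_top
  have hπm : ∀ a, π a ∈ IsLocalRing.maximalIdeal (A ⧸ I) ↔ a ∈ m := fun a => by
    have : IsLocalHom π := IsLocalHom.of_surjective π Ideal.Quotient.mk_surjective
    rw [IsLocalRing.mem_maximalIdeal, IsLocalRing.mem_maximalIdeal, mem_nonunits_iff,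
      mem_nonunits_iff, isUnit_map_iff]
  obtain ⟨l, hl, hprod⟩ := hB.exists_list (p := p)
  obtain ⟨s, x, rfl⟩ : ∃ (s : ℕ) (x : Fin s → A ⧸ I), l = List.ofFn x := ⟨_, l.get, by simp⟩
  have hlx : ∀ {R : Type _} (x : Fin s → R), {y | y ∈ List.ofFn x} = Set.range x := fun x => by
    ext
    simp [List.mem_ofFn]
  rw [bot_sup_eq, hlx] at hl
  rw [List.map_ofFn, List.prod_ofFn, Ideal.mem_bot] at hprod
  simp only [Function.comp_apply] at hprod
  have hxm : ∀ i, x i ∈ IsLocalRing.maximalIdeal (A ⧸ I) := fun i =>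
    hl ▸ Ideal.subset_span (Set.mem_range_self i)
  have hxp : ∀ i, x i ^ p = 0 := fun i => hB.pow_char_eq_zero hprime (hxm i)
  have hind : ∀ a : Fin s → A ⧸ I, ∑ i, a i * x i ∈ IsLocalRing.maximalIdeal (A ⧸ I) ^ 2 →
      ∀ i, a i ∈ IsLocalRing.maximalIdeal (A ⧸ I) := fun a ha i =>
    IsLocalRing.mem_maximalIdeal_of_sum_mem_sq hprime.two_le hl hxp hprod ha i
  have hrs : r = s := by
    rw [hr, ← IsLocalRing.card_eq_embDim hl hind, Fintype.card_fin]
  choose y hy using fun i => Ideal.Quotient.mk_surjective (x i)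
  obtain ⟨t, z, hzI, hIz, hz⟩ := IsLocalRing.exists_basis_mod_sq hIm
  have hyp : ∀ i, y i ^ p ∈ I := fun i => by
    rw [← Ideal.Quotient.eq_zero_iff_mem, map_pow, hy, hxp]
  have hmI : m ≤ Ideal.span (Set.range y) ⊔ I := by
    intro f hf
    have := (hπm f).2 hf
    rw [← hl] at this
    obtain ⟨e, he⟩ := Ideal.mem_span_range_iff_exists_fun.1 this
    choose a ha using fun i => Ideal.Quotient.mk_surjective (e i)
    have h1 : f - ∑ i, a i * y i ∈ I := by
      rw [← Ideal.Quotient.eq_zero_iff_mem, map_sub, map_sum, sub_eq_zero, ← hπ, ← he]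
      exact Finset.sum_congr rfl fun i _ => by rw [map_mul, ha, hy]
    have h2 := Submodule.add_mem_sup (Ideal.mem_span_range_iff_exists_fun.2
      ⟨a, rfl⟩ : ∑ i, a i * y i ∈ Ideal.span (Set.range y)) h1
    simpa using h2
  have hym : Ideal.span (Set.range y) ≤ m := by
    rw [Ideal.span_le]
    rintro _ ⟨i, rfl⟩
    exact (hπm _).1 ((hy i).symm ▸ hxm i)
  have hzleI : Ideal.span (Set.range z) ≤ I := by
    rw [Ideal.span_le]
    rintro _ ⟨i, rfl⟩
    exact hzI i
  have hmyz : Ideal.span (Set.range y) ⊔ Ideal.span (Set.range z) = m := by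
    refine le_antisymm (sup_le hym (hzleI.trans hIm)) ?_
    refine Submodule.le_of_le_smul_of_le_jacobson_bot (I := m) (IsNoetherian.noetherian m)
      (IsLocalRing.maximalIdeal_le_jacobson _) ?_
    rw [smul_eq_mul, ← pow_two, sup_assoc]
    exact hmI.trans (sup_le_sup_left hIz _)
  have hspan : ∀ u : Fin s → A, Ideal.span (Set.range (Fin.append u z)) =
      Ideal.span (Set.range u) ⊔ Ideal.span (Set.range z) := fun u => by
    rw [← Ideal.span_union]
    congr 1
    ext w
    constructor
    · rintro ⟨i, rfl⟩
      refine Fin.addCases (fun i => ?_) (fun i => ?_) i <;> simp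
    · rintro (⟨i, rfl⟩ | ⟨i, rfl⟩)
      exacts [⟨Fin.castAdd t i, by simp⟩, ⟨Fin.natAdd s i, by simp⟩]
  have hnst : n = s + t := by
    rw [hn, ← Fintype.card_fin (s + t)]
    refine (IsLocalRing.card_eq_embDim ((hspan y).trans hmyz) fun a ha => ?_).symm
    rw [Fin.sum_univ_add] at ha
    simp only [Fin.append_left, Fin.append_right] at ha
    -- Modulo `I` the `z` terms vanish, so independence of the `x i` applies. The `y` terms then lie
    -- in `m ^ 2`, leaving a relation among the `z` alone.
    have h1 : ∀ i, a (Fin.castAdd t i) ∈ m := by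
      intro i
      rw [← hπm]
      refine hind (fun i => π (a (Fin.castAdd t i))) ?_ i
      have h2 := Ideal.mem_map_of_mem π ha
      rw [Ideal.map_pow, map_add, Ideal.Quotient.eq_zero_iff_mem.2
        (I.sum_mem fun i _ => I.mul_mem_left _ (hzI i)), add_zero, map_sum] at h2
      simp only [map_mul, hπ, hy] at h2
      refine Ideal.pow_right_mono (Ideal.map_le_iff_le_comap.2 fun b hb => ?_) 2 h2
      exact (hπm b).2 hb
    have h2 : ∀ i, a (Fin.natAdd s i) ∈ m := by
      refine hz (fun i => a (Fin.natAdd s i)) ?_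
      refine (Ideal.add_mem_iff_right _ ?_).1 ha
      rw [pow_two]
      exact Ideal.sum_mem _ fun i _ =>
        Ideal.mul_mem_mul (h1 i) (hym (Ideal.subset_span (Set.mem_range_self i)))
    exact fun i => Fin.addCases h1 h2 i
  subst hrs hnst
  refine ⟨Nat.le_add_right _ _, Fin.append y z,
    IsLocalRing.isMinimalGenerators hn ((hspan y).trans hmyz), ?_⟩
  have hif : (fun i : Fin (r + t) => if (i : ℕ) < r then Fin.append y z i ^ p
      else Fin.append y z i) = Fin.append (fun i => y i ^ p) z := by
    funext i
    refine Fin.addCases (fun i => ?_) (fun i => ?_) i <;> simp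
  rw [hif, hspan]
  have hJI : Ideal.span (Set.range fun i => y i ^ p) ⊔ Ideal.span (Set.range z) ≤ I := by
    refine sup_le ?_ hzleI
    rw [Ideal.span_le]
    rintro _ ⟨i, rfl⟩
    exact hyp i
  refine le_antisymm (fun f hf => ?_) hJI
  by_contra hfJ
  obtain ⟨g, hg, hgf⟩ := Ideal.exists_prod_pow_mul_mem_sup_span (List.ofFn y) hp _
    (fun w hw => by
      obtain ⟨i, rfl⟩ := (List.mem_ofFn' y w).1 hw
      exact Ideal.mem_sup_left (Ideal.subset_span (Set.mem_range_self i))) hfJ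
  rw [hlx] at hg
  rw [List.map_ofFn, List.prod_ofFn] at hgf
  -- `g` avoids `J + (y)`, which contains `(y) + (z) = m`.
  have hgu : IsUnit g := IsLocalRing.notMem_maximalIdeal.1 fun hgm => hg <| by
    rw [← hm, ← hmyz] at hgm
    have hle : Ideal.span (Set.range y) ⊔ Ideal.span (Set.range z) ≤
        Ideal.span (Set.range fun i => y i ^ p) ⊔ Ideal.span (Set.range z) ⊔
          Ideal.span (Set.range y) :=
      sup_le le_sup_right (le_sup_right.trans le_sup_left)
    exact hle hgm
  have h1 := (Ideal.mul_unit_mem_iff_mem I hgu).1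
    (sup_le hJI ((Ideal.span_singleton_le_iff_mem _).2 hf) hgf)
  rw [← Ideal.Quotient.eq_zero_iff_mem, map_prod] at h1
  simp only [Function.comp_apply, map_pow, hy] at h1
  exact hprod h1
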